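/- For linear orders $A,B$ write $A\trianglelefteq B$ if $A=\varnothing$ or there is an epimorphism from $B$ onto $A$, i.e. a surjection $f:B\to A$ such that $x\le_B y$ implies $f(x)\le_A f(y)$. A $\trianglelefteq$-antichain is a set of linear orders any two distinct members of which are $\trianglelefteq$-incomparable. A nonempty linear order is $\aleph_1$-dense if it has no left or right endpoint and every interval $[a,b]$ with $a<b$ has size $\aleph_1$. A Countryman line is an uncountable linear order $C$ such that $C^2$, with the product order ($(x,y)\le(x',y')$ iff $x\le_C x'$ and $y\le_C y'$), is the union of countably many chains. 1. (In $\mathsf{ZFC}$.) There is a $\trianglelefteq$-antichain of size $\aleph_1$ consisting of $\aleph_1$-dense Countryman lines. 2. Assume $\mathsf{MA}_{\aleph_1}$: for every nonempty ccc partial preorder $P$ and every family of at most $\aleph_1$ dense subsets of $P$ there is a filter on $P$ meeting all of them. Then there is a $\trianglelefteq$-antichain of size $2^{\aleph_1}$ consisting of $\aleph_1$-dense Countryman lines. -/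

import Mathlib

open Cardinal

universe u

/-- `A ⊴ B`: either `A` is empty, or there is an epimorphism (a monotone surjection) from `B`
onto `A`. -/
def EpiLE (A B : LinOrd.{u}) : Prop :=
  IsEmpty A ∨ ∃ f : B →o A, Function.Surjective f

/-- A nonempty linear order without endpoints all of whose intervals `[a, b]`, `a < b`, have
cardinality `κ`. -/
def IsCardinalDense (κ : Cardinal.{u}) (A : Type u) [LinearOrder A] : Prop :=
  Nonempty A ∧ NoMinOrder A ∧ NoMaxOrder A ∧ ∀ a b : A, a < b → #(Set.Icc a b) = κ

/-- A Countryman line: an uncountable linear order whose square, with the product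
(coordinatewise) order, is the union of countably many chains. -/
def IsCountryman (C : Type u) [LinearOrder C] : Prop :=
  Uncountable C ∧
    ∃ S : ℕ → Set (C × C), (∀ n, IsChain (· ≤ ·) (S n)) ∧ ⋃ n, S n = Set.univ

/-- Two conditions of a forcing notion are compatible if they have a common extension
(smaller conditions are stronger). -/
def ForcingCompatible {P : Type u} [Preorder P] (p q : P) : Prop :=
  ∃ r, r ≤ p ∧ r ≤ q

/-- The countable chain condition: every set of pairwise incompatible conditions is countable. -/
def ForcingCCC (P : Type u) [Preorder P] : Prop :=
  ∀ W : Set P, W.Pairwise (fun p q => ¬ ForcingCompatible p q) → W.Countable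

/-- A set of conditions is dense if every condition has an extension in it. -/
def ForcingDense {P : Type u} [Preorder P] (D : Set P) : Prop :=
  ∀ p, ∃ d ∈ D, d ≤ p

/-- Martin's axiom for `ℵ₁` dense sets: for every nonempty ccc forcing notion and every family of
at most `ℵ₁` dense sets there is a filter that meets all of them. -/
def MartinAxiomAlephOne : Prop :=
  ∀ (P : Type) [Preorder P] [Nonempty P], ForcingCCC P →
    ∀ 𝒟 : Set (Set P), #𝒟 ≤ ℵ₁ → (∀ D ∈ 𝒟, ForcingDense D) →
      ∃ G : Order.PFilter P, ∀ D ∈ 𝒟, ((G : Set P) ∩ D).Nonempty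

/-! Fix a coherent sequence of finite-to-one functions `E α : α → ℕ`, `α < ω₁`. The line of `X ⊆ ω₁`
consists of the finite modifications of `E α`, for limit `α ∈ X`, padded with zeros and ordered
lexicographically.

These lines are Countryman because coherence gives every pair of nodes a code from a countable set,
and two pairs with the same code first split in the same direction in both coordinates
(`le_or_le_of_isPairCode`).

To tell the lines apart, fix `α` and put nodes of height at least `α` in one class when they agree
below `α`. Classes are convex. If `α ∈ X`, every class has a least element, the common restriction
padded with zeros; if `α ∉ X`, none has one. At a closure point `α` of an epimorphism and of a
section of it, a least element would be sent to a least element, so no epimorphism exists from the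
line of `X` onto that of `Y` when `X \ Y` is stationary (`not_surjective_of_stationary`). Ulam's
disjoint stationary sets yield `2 ^ ℵ₁` sets with pairwise stationary differences, and subfamilies
have every smaller size. -/

set_option linter.unusedSectionVars false


/-! ### Well-orders of type `ω₁` -/

/-- An uncountable linear order with countable initial segments; together with well-foundedness,
this says that the order type is `ω₁`. -/
class IsOmegaOne (Ω : Type*) [LinearOrder Ω] : Prop where
  countable_Iio : ∀ a : Ω, (Set.Iio a).Countable
  uncountable : Uncountable Ω

namespace IsOmegaOne

variable {Ω : Type*} [LinearOrder Ω] [IsOmegaOne Ω]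

theorem countable_Iic (a : Ω) : (Set.Iic a).Countable := by
  rw [← Set.Iio_insert]
  exact (countable_Iio a).insert a

theorem exists_bound {s : Set Ω} (hs : s.Countable) : ∃ b, ∀ a ∈ s, a < b := by
  by_contra! h
  refine (not_countable_iff (α := Ω)).2 uncountable (Set.countable_univ_iff.1 ?_)
  refine (hs.biUnion fun a _ => countable_Iic a).mono fun b _ => ?_
  obtain ⟨a, ha, hab⟩ := h b
  exact Set.mem_biUnion ha hab

theorem exists_gt (a : Ω) : ∃ b, a < b :=
  let ⟨b, hb⟩ := exists_bound (Set.countable_singleton a)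
  ⟨b, hb a rfl⟩

instance : Nonempty Ω :=
  have := uncountable (Ω := Ω)
  inferInstance

/-- Take the least strict upper bound of the iterates of a bounding function `h`: anything below it
is at most some iterate, and the next iterate bounds its image under `g`. -/
theorem exists_closed [WellFoundedLT Ω] (g : Ω → Ω) (ξ : Ω) :
    ∃ α, ξ < α ∧ ∀ η < α, g η < α := by
  have hb : ∀ a : Ω, ∃ b, a < b ∧ ∀ η ≤ a, g η < b := by
    intro a
    obtain ⟨b, hb⟩ := exists_bound (((countable_Iic a).image g).insert a)
    exact ⟨b, hb a (by simp), fun η hη => hb _ (Or.inr ⟨η, hη, rfl⟩)⟩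
  choose h h1 h2 using hb
  let T : Set Ω := {b | ∀ n : ℕ, h^[n] ξ < b}
  have hT : T.Nonempty := by
    obtain ⟨b, hb⟩ := exists_bound (Set.countable_range fun n : ℕ => h^[n] ξ)
    exact ⟨b, fun n => hb _ ⟨n, rfl⟩⟩
  have hm := WellFounded.min_mem (wellFounded_lt (α := Ω)) T hT
  refine ⟨_, hm 0, fun η hη => ?_⟩
  have : η ∉ T := fun hη' => WellFounded.not_lt_min (wellFounded_lt (α := Ω)) T hη' hη
  simp only [T, Set.mem_ofPred_eq, not_forall, not_lt] at this
  obtain ⟨n, hn⟩ := this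
  refine (h2 _ η hn).trans ?_
  have := hm (n + 1)
  rwa [Function.iterate_succ_apply'] at this

/-- A set is stationary if it contains a nonzero closure point of every function. -/
def Stationary (S : Set Ω) : Prop :=
  ∀ g : Ω → Ω, ∃ α ∈ S, ¬ IsMin α ∧ ∀ η < α, g η < α

theorem Stationary.mono {S T : Set Ω} (hS : Stationary S) (h : S ⊆ T) : Stationary T := fun g =>
  let ⟨α, hα, hg⟩ := hS g
  ⟨α, h hα, hg⟩

theorem isSuccLimit_of_closed {g : Ω → Ω} (hg : ∀ η, η < g η) {α : Ω} (hα : ¬ IsMin α)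
    (h : ∀ η < α, g η < α) : Order.IsSuccLimit α :=
  ⟨hα, fun η hη => hη.2 (hg η) (h η hη.1)⟩

theorem Stationary.exists_isSuccLimit {S : Set Ω} (hS : Stationary S) (ξ : Ω) :
    ∃ α ∈ S, Order.IsSuccLimit α ∧ ξ < α := by
  choose g hg using exists_gt (Ω := Ω)
  obtain ⟨α, hα, hm, hc⟩ := hS fun η => max (g η) (g ξ)
  refine ⟨α, hα, isSuccLimit_of_closed (fun η => lt_max_of_lt_left (hg η)) hm hc, ?_⟩
  obtain ⟨η, hη⟩ := not_isMin_iff.1 hm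
  exact (hg ξ).trans ((le_max_right _ _).trans_lt (hc η hη))

theorem stationary_Ioi [WellFoundedLT Ω] (ξ : Ω) : Stationary (Set.Ioi ξ) := fun g =>
  let ⟨α, hα, hg⟩ := exists_closed g ξ
  ⟨α, hα, hα.not_isMin, hg⟩

theorem Stationary.exists_of_iUnion {S : ℕ → Set Ω} (hS : Stationary (⋃ n, S n)) :
    ∃ n, Stationary (S n) := by
  by_contra! h
  simp only [Stationary, not_forall, not_exists, not_and] at h
  choose g hg using h
  have hb : ∀ η : Ω, ∃ b, ∀ n, g n η < b := by
    intro η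
    obtain ⟨b, hb⟩ := exists_bound (Set.countable_range fun n => g n η)
    exact ⟨b, fun n => hb _ ⟨n, rfl⟩⟩
  choose G hG using hb
  obtain ⟨α, hα, hm, hc⟩ := hS G
  obtain ⟨n, hn⟩ := Set.mem_iUnion.1 hα
  obtain ⟨η, hη, h'⟩ := hg n α hn hm
  exact h' ((hG η n).trans (hc η hη))

/-- Ulam: there is an uncountable family of pairwise disjoint stationary sets. -/
theorem exists_disjoint_stationary [WellFoundedLT Ω] :
    ∃ (I : Set Ω) (S : Ω → Set Ω), ¬ I.Countable ∧ (∀ i ∈ I, Stationary (S i)) ∧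
      ∀ i ∈ I, ∀ j ∈ I, i ≠ j → Disjoint (S i) (S j) := by
  have he : ∀ β : Ω, ∃ e : Ω → ℕ, Set.InjOn e (Set.Iio β) := fun β =>
    Set.countable_iff_exists_injOn.1 (countable_Iio β)
  choose e he using he
  -- Ulam matrix: for fixed `n` the sets `U n ξ` are disjoint by injectivity of `e β`; for fixed `ξ`
  -- they cover a final segment, so one is stationary. Some `n` serves uncountably many `ξ`.
  let U : ℕ → Ω → Set Ω := fun n ξ => {β | ξ < β ∧ e β ξ = n}
  have hU : ∀ ξ, ∃ n, Stationary (U n ξ) := by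
    intro ξ
    refine Stationary.exists_of_iUnion ((stationary_Ioi ξ).mono fun β hβ => ?_)
    exact Set.mem_iUnion.2 ⟨e β ξ, hβ, rfl⟩
  choose N hN using hU
  obtain ⟨n, hn⟩ : ∃ n, ¬ (N ⁻¹' {n}).Countable := by
    by_contra! h
    refine (not_countable_iff (α := Ω)).2 uncountable (Set.countable_univ_iff.1 ?_)
    refine (Set.countable_iUnion h).mono fun a _ => Set.mem_iUnion.2 ⟨N a, rfl⟩
  refine ⟨N ⁻¹' {n}, U n, hn, ?_, ?_⟩
  · rintro i rfl
    exact hN i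
  · intro i _ j _ hij
    refine Set.disjoint_left.2 fun β hi hj => hij ?_
    exact he β hi.1 hj.1 (hi.2.trans hj.2.symm)

/-- There are `2 ^ ℵ₁` many sets with pairwise stationary differences. -/
theorem exists_stationary_diff [WellFoundedLT Ω] :
    ∃ (I : Set Ω) (X : Set I → Set Ω), Uncountable I ∧
      ∀ K L, K ≠ L → Stationary (X K \ X L) := by
  obtain ⟨I, S, hI, hS, hd⟩ := exists_disjoint_stationary (Ω := Ω)
  have hI' : Uncountable I := not_countable_iff.1 hI
  -- Each `i` receives two disjoint stationary sets, one for `i ∈ K` and one for `i ∉ K`. An `i` on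
  -- which `K` and `L` differ puts one of them inside `X K \ X L`.
  have hcard : #(I × Prop) ≤ #I := by
    rw [Cardinal.mk_prod, Cardinal.mk_Prop]
    simp only [Cardinal.lift_uzero, Cardinal.lift_ofNat]
    exact (Cardinal.mul_eq_left (Cardinal.aleph0_le_mk I)
      ((Cardinal.natCast_lt_aleph0 (n := 2)).le.trans (Cardinal.aleph0_le_mk I)) two_ne_zero).le
  obtain ⟨φ, hφ⟩ := hcard
  refine ⟨I, fun K => {β | ∃ i, β ∈ S (φ (i, i ∈ K))}, hI', fun K L hKL => ?_⟩
  obtain ⟨i, hi⟩ : ∃ i, ¬ (i ∈ K ↔ i ∈ L) := by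
    by_contra! h
    exact hKL (Set.ext h)
  refine (hS _ (φ (i, i ∈ K)).2).mono fun β hβ => ⟨⟨i, hβ⟩, ?_⟩
  rintro ⟨j, hj⟩
  by_cases h : φ (i, i ∈ K) = φ (j, j ∈ L)
  · have h' := hφ h
    simp only [Prod.mk.injEq, eq_iff_iff] at h'
    obtain ⟨rfl, h'⟩ := h'
    exact hi h'
  · exact Set.disjoint_left.1 (hd _ (φ _).2 _ (φ _).2 fun h' => h (Subtype.ext h')) hβ hj

end IsOmegaOne

/-! ### Coherent sequences of finite-to-one functions -/

/-- A coherent sequence of finite-to-one functions `E α : α → ℕ`, extended by zero. -/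
structure IsCoherent {Ω : Type*} [LinearOrder Ω] (E : Ω → Ω → ℕ) : Prop where
  eq_zero : ∀ {α ξ}, α ≤ ξ → E α ξ = 0
  finite_le : ∀ α n, {ξ | ξ < α ∧ E α ξ ≤ n}.Finite
  finite_ne : ∀ {α β}, α ≤ β → {ξ | ξ < α ∧ E α ξ ≠ E β ξ}.Finite

section walk

variable {Ω : Type*} [LinearOrder Ω] [WellFoundedLT Ω]

open Classical in
/-- The maximal weight of the walk from `β` to `ξ` along the ladders `c`. -/
noncomputable def walkWeight {Ω : Type*} [LinearOrder Ω] [WellFoundedLT Ω] (c : Ω → ℕ → Ω)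
    (ξ β : Ω) : ℕ :=
  if _h : {n | ξ ≤ c β n ∧ c β n < β}.Nonempty then
    max (sInf {n | ξ ≤ c β n ∧ c β n < β}) (walkWeight c ξ (c β (sInf {n | ξ ≤ c β n ∧ c β n < β})))
  else 0
termination_by wellFounded_lt.wrap β
decreasing_by
  simp only [WellFounded.val_wrap]
  exact (Nat.sInf_mem _h).2

theorem walkWeight_of_le (c : Ω → ℕ → Ω) {ξ β : Ω} (h : β ≤ ξ) : walkWeight c ξ β = 0 := by
  rw [walkWeight, dif_neg]
  rintro ⟨n, h1, h2⟩
  exact absurd (h.trans h1) h2.not_ge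

/-- One step of the walk. The ladder `c β` may take values outside `Iio β`, hence the guards `c β m
< β`. -/
theorem walkWeight_of_lt {c : Ω → ℕ → Ω} (hc : ∀ β, ∀ ξ < β, ∃ n, c β n = ξ) {ξ β : Ω}
    (h : ξ < β) : ∃ n, ξ ≤ c β n ∧ c β n < β ∧ (∀ m < n, c β m < β → c β m < ξ) ∧
      walkWeight c ξ β = max n (walkWeight c ξ (c β n)) := by
  have hex : {n | ξ ≤ c β n ∧ c β n < β}.Nonempty := by
    obtain ⟨n, hn⟩ := hc β ξ h
    exact ⟨n, hn.ge, hn ▸ h⟩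
  refine ⟨_, (Nat.sInf_mem hex).1, (Nat.sInf_mem hex).2, fun m hm hβ => ?_, ?_⟩
  · by_contra! h'
    exact Nat.notMem_of_lt_sInf hm ⟨h', hβ⟩
  · rw [walkWeight, dif_pos hex]

/-- Weight at most `n` leaves finitely many choices for the first step; induction handles the rest
of the walk. -/
theorem walkWeight_finite_le {c : Ω → ℕ → Ω} (hc : ∀ β, ∀ ξ < β, ∃ n, c β n = ξ) (β : Ω) (n : ℕ) :
    {ξ | ξ < β ∧ walkWeight c ξ β ≤ n}.Finite := by
  induction β using WellFoundedLT.induction with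
  | ind β ih =>
    have hf : (⋃ m ∈ {m | m ≤ n ∧ c β m < β},
        insert (c β m) {ξ | ξ < c β m ∧ walkWeight c ξ (c β m) ≤ n}).Finite :=
      ((Set.finite_Iic n).subset fun m hm => hm.1).biUnion fun m hm => (ih _ hm.2).insert _
    refine hf.subset fun ξ hξ => ?_
    obtain ⟨m, h1, h2, -, h4⟩ := walkWeight_of_lt hc hξ.1
    have h5 := hξ.2
    rw [h4, max_le_iff] at h5
    refine Set.mem_biUnion (x := m) ⟨h5.1, h2⟩ ?_
    rcases h1.eq_or_lt with h | h
    · exact Or.inl h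
    · exact Or.inr ⟨h, h5.2⟩

theorem walkWeight_finite_ne {c : Ω → ℕ → Ω} (hc : ∀ β, ∀ ξ < β, ∃ n, c β n = ξ) (β α : Ω)
    (hαβ : α ≤ β) : {ξ | ξ < α ∧ walkWeight c ξ α ≠ walkWeight c ξ β}.Finite := by
  induction β using WellFoundedLT.induction generalizing α with
  | ind β ihβ =>
    induction α using WellFoundedLT.induction with
    | ind α ihα =>
      rcases hαβ.eq_or_lt with rfl | hlt
      · simp
      -- As `ξ < α ≤ c β N`, the walk from `β` to `ξ` starts with an index `m ≤ N`. If `m = N`,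
      -- compare `α` with `c β N`; the maximum with `N` matters only where the weight is small. If
      -- `m < N`, compare both `α` and `β` with `c β m < α`.
      obtain ⟨N, h1, h2, h3, -⟩ := walkWeight_of_lt hc hlt
      have hlast := (ihβ _ h2 α h1).union (walkWeight_finite_le hc α N)
      have hfirst : (⋃ m ∈ {m | m < N ∧ c β m < β},
          insert (c β m) ({ξ | ξ < c β m ∧ walkWeight c ξ (c β m) ≠ walkWeight c ξ β} ∪
            {ξ | ξ < c β m ∧ walkWeight c ξ (c β m) ≠ walkWeight c ξ α})).Finite := by
        refine ((Set.finite_Iio N).subset fun m hm => hm.1).biUnion fun m hm => ?_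
        have hm' := h3 m hm.1 hm.2
        exact ((ihα _ hm' (hm'.trans hlt).le).union (ihβ _ hlt _ hm'.le)).insert _
      refine (hlast.union hfirst).subset fun ξ hξ => ?_
      obtain ⟨m, k1, k2, k3, k4⟩ := walkWeight_of_lt hc (hξ.1.trans hlt)
      have hmN : m ≤ N := by
        by_contra! hNm
        exact absurd (k3 N hNm h2) (hξ.1.le.trans h1).not_gt
      rcases hmN.eq_or_lt with rfl | hmN
      · left
        by_cases hle : walkWeight c ξ α ≤ m
        · exact Or.inr ⟨hξ.1, hle⟩
        · refine Or.inl ⟨hξ.1, fun heq => hξ.2 ?_⟩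
          rw [k4, ← heq, max_eq_right (not_le.1 hle).le]
      · right
        refine Set.mem_biUnion (x := m) ⟨hmN, k2⟩ ?_
        rcases k1.eq_or_lt with h | h
        · exact Or.inl h
        · by_cases heq : walkWeight c ξ (c β m) = walkWeight c ξ β
          · exact Or.inr (Or.inr ⟨h, fun h' => hξ.2 (h'.symm.trans heq)⟩)
          · exact Or.inr (Or.inl ⟨h, heq⟩)

theorem exists_isCoherent [IsOmegaOne Ω] : ∃ E : Ω → Ω → ℕ, IsCoherent E := by
  have hc : ∀ β : Ω, ∃ f : ℕ → Ω, Set.Iio β ⊆ Set.range f := fun β =>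
    Set.countable_iff_exists_subset_range.1 (IsOmegaOne.countable_Iio β)
  choose c hc using hc
  exact ⟨fun β ξ => walkWeight c ξ β, walkWeight_of_le c, walkWeight_finite_le hc,
    walkWeight_finite_ne hc _ _⟩

end walk

/-! ### Lexicographically ordered coherent trees -/

theorem Order.IsSuccLimit.infinite_Ico {Ω : Type*} [LinearOrder Ω] {α β : Ω}
    (hα : Order.IsSuccLimit α) (h : β < α) : (Set.Ico β α).Infinite := by
  intro hfin
  obtain ⟨m, hm, hmax⟩ := Set.exists_max_image _ id hfin ⟨β, le_rfl, h⟩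
  obtain ⟨c, h1, h2⟩ := exists_lt_lt_of_not_covBy hm.2 (hα.2 m)
  exact absurd h1 (hmax c ⟨hm.1.trans h1.le, h2⟩).not_gt

section Node

variable {Ω : Type*} [LinearOrder Ω] {E : Ω → Ω → ℕ} {α β γ δ : Ω} {t : Ω → ℕ}

/-- `t` is a finite modification of `E α` on `α` and vanishes from `α` on. -/
def IsNode (E : Ω → Ω → ℕ) (α : Ω) (t : Ω → ℕ) : Prop :=
  (∀ ξ, α ≤ ξ → t ξ = 0) ∧ {ξ | ξ < α ∧ t ξ ≠ E α ξ}.Finite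

theorem IsCoherent.isNode (hE : IsCoherent E) (α : Ω) : IsNode E α (E α) :=
  ⟨fun _ => hE.eq_zero, by simp⟩

theorem IsNode.finite_le (hE : IsCoherent E) (h : IsNode E α t) (n : ℕ) :
    {ξ | ξ < α ∧ t ξ ≤ n}.Finite := by
  refine (h.2.union (hE.finite_le α n)).subset fun ξ hξ => ?_
  by_cases he : t ξ = E α ξ
  · exact Or.inr ⟨hξ.1, he ▸ hξ.2⟩
  · exact Or.inl ⟨hξ.1, he⟩

theorem IsNode.finite_ne (hE : IsCoherent E) {s : Ω → ℕ} (hs : IsNode E α s) (ht : IsNode E β t)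
    (hαβ : α ≤ β) : {ξ | ξ < α ∧ s ξ ≠ t ξ}.Finite := by
  refine ((hs.2.union ht.2).union (hE.finite_ne hαβ)).subset fun ξ hξ => ?_
  by_cases h1 : s ξ = E α ξ
  · by_cases h2 : t ξ = E β ξ
    · exact Or.inr ⟨hξ.1, fun h => hξ.2 (by rw [h1, h2, h])⟩
    · exact Or.inl (Or.inr ⟨hξ.1.trans_le hαβ, h2⟩)
  · exact Or.inl (Or.inl ⟨hξ.1, h1⟩)

theorem IsNode.exists_ne_zero (hE : IsCoherent E) (h : IsNode E γ t) (hα : Order.IsSuccLimit α)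
    (hαγ : α ≤ γ) (hβ : β < α) : ∃ ξ, β ≤ ξ ∧ ξ < α ∧ t ξ ≠ 0 := by
  by_contra! h0
  refine hα.infinite_Ico hβ ((h.finite_le hE 0).subset fun ξ hξ => ?_)
  exact ⟨hξ.2.trans_le hαγ, (h0 ξ hξ.1 hξ.2).le⟩

/-- Padding with zeros loses no information at limit heights, since a finite-to-one function is
nonzero cofinally below a limit. -/
theorem IsNode.height_unique (hE : IsCoherent E) (hα : Order.IsSuccLimit α)
    (hβ : Order.IsSuccLimit β) (h1 : IsNode E α t) (h2 : IsNode E β t) : α = β := by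
  rcases lt_trichotomy α β with h | h | h
  · obtain ⟨ξ, h3, -, h4⟩ := h2.exists_ne_zero hE hβ le_rfl h
    exact absurd (h1.1 ξ h3) h4
  · exact h
  · obtain ⟨ξ, h3, -, h4⟩ := h1.exists_ne_zero hE hα le_rfl h
    exact absurd (h2.1 ξ h3) h4

/-- Follow `t` below `δ`, take the value `v` at `δ`, and follow `s` above `δ`. -/
def graft (t : Ω → ℕ) (δ : Ω) (v : ℕ) (s : Ω → ℕ) (ξ : Ω) : ℕ :=
  if ξ < δ then t ξ else if ξ = δ then v else s ξ

theorem graft_of_lt {ξ : Ω} (t s : Ω → ℕ) (v : ℕ) (h : ξ < δ) : graft t δ v s ξ = t ξ := if_pos h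

theorem graft_self (t s : Ω → ℕ) (δ : Ω) (v : ℕ) : graft t δ v s δ = v := by simp [graft]

theorem graft_of_gt {ξ : Ω} (t s : Ω → ℕ) (v : ℕ) (h : δ < ξ) : graft t δ v s ξ = s ξ := by
  simp [graft, h.not_gt, h.ne']

theorem IsNode.graft (hE : IsCoherent E) (h : IsNode E α t) (hα : δ ≤ α) (hγ : δ < γ) (v : ℕ) :
    IsNode E γ (graft t δ v (E γ)) := by
  refine ⟨fun ξ hξ => ?_, ?_⟩
  · rw [graft_of_gt _ _ _ (hγ.trans_le hξ), hE.eq_zero hξ]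
  · refine (((h.2.union (hE.finite_ne hα)).union (hE.finite_ne hγ.le)).insert δ).subset
      fun ξ hξ => ?_
    rcases lt_trichotomy ξ δ with hlt | rfl | hgt
    · right
      have h1 := hξ.2
      rw [graft_of_lt _ _ _ hlt] at h1
      by_cases h2 : t ξ = E α ξ
      · by_cases h3 : E δ ξ = E α ξ
        · exact Or.inr ⟨hlt, fun h4 => h1 (by rw [h2, ← h3, h4])⟩
        · exact Or.inl (Or.inr ⟨hlt, h3⟩)
      · exact Or.inl (Or.inl ⟨hlt.trans_le hα, h2⟩)
    · exact Or.inl rfl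
    · exact absurd (graft_of_gt _ _ _ hgt) hξ.2

/-- A node is determined by the finite set of its places of departure from `E α`, with its values
there. -/
theorem countable_isNode [IsOmegaOne Ω] (E : Ω → Ω → ℕ) (α : Ω) : {t | IsNode E α t}.Countable := by
  have : Countable (Set.Iio α) := (IsOmegaOne.countable_Iio α).to_subtype
  have hfin : ∀ t : {t | IsNode E α t}, {ξ : Set.Iio α | t.1 ξ ≠ E α ξ}.Finite := fun t =>
    (t.2.2.preimage Subtype.val_injective.injOn).subset fun ξ hξ => ⟨ξ.2, hξ⟩
  refine Set.countable_coe_iff.1 (Function.Injective.countable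
    (f := fun t : {t | IsNode E α t} => (hfin t).toFinset.image fun ξ : Set.Iio α => (ξ, t.1 ξ)) ?_)
  intro s t hst
  have key : ∀ ξ : Set.Iio α, ∀ n, (n ≠ E α ξ ∧ s.1 ξ = n) ↔ (n ≠ E α ξ ∧ t.1 ξ = n) := by
    intro ξ n
    have := Finset.ext_iff.1 hst (ξ, n)
    simp only [Finset.mem_image, Set.Finite.mem_toFinset, Set.mem_ofPred_eq, Prod.mk.injEq] at this
    constructor
    · rintro ⟨h1, rfl⟩
      obtain ⟨η, h2, rfl, h3⟩ := this.1 ⟨ξ, h1, rfl, rfl⟩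
      exact ⟨h1, h3⟩
    · rintro ⟨h1, rfl⟩
      obtain ⟨η, h2, rfl, h3⟩ := this.2 ⟨ξ, h1, rfl, rfl⟩
      exact ⟨h1, h3⟩
  refine Subtype.ext (funext fun ξ => ?_)
  rcases lt_or_ge ξ α with h | h
  · by_cases h1 : s.1 ξ = E α ξ
    · by_cases h2 : t.1 ξ = E α ξ
      · rw [h1, h2]
      · exact ((key ⟨ξ, h⟩ _).2 ⟨h2, rfl⟩).2
    · exact ((key ⟨ξ, h⟩ _).1 ⟨h1, rfl⟩).2.symm
  · rw [s.2.1 ξ h, t.2.1 ξ h]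

end Node

/-- The line of all nodes of limit height in `X`, ordered lexicographically. -/
abbrev TreeLine {Ω : Type*} [LinearOrder Ω] (E : Ω → Ω → ℕ) (X : Set Ω) : Type _ :=
  {t : Lex (Ω → ℕ) // ∃ α ∈ X, Order.IsSuccLimit α ∧ IsNode E α (ofLex t)}

namespace TreeLine

variable {Ω : Type*} [LinearOrder Ω] [WellFoundedLT Ω] {E : Ω → Ω → ℕ} {X : Set Ω}

/-- The function underlying a member of a tree line. -/
def fn (t : TreeLine E X) : Ω → ℕ := ofLex t.1

/-- The height of a member of a tree line. -/
noncomputable def ht (t : TreeLine E X) : Ω := t.2.choose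

theorem ht_mem (t : TreeLine E X) : t.ht ∈ X := t.2.choose_spec.1

theorem ht_lim (t : TreeLine E X) : Order.IsSuccLimit t.ht := t.2.choose_spec.2.1

theorem isNode (t : TreeLine E X) : IsNode E t.ht t.fn := t.2.choose_spec.2.2

theorem lt_iff {s t : TreeLine E X} :
    s < t ↔ ∃ δ, (∀ ξ < δ, s.fn ξ = t.fn ξ) ∧ s.fn δ < t.fn δ := Iff.rfl

theorem ext_fn {s t : TreeLine E X} (h : s.fn = t.fn) : s = t := Subtype.ext h

/-- The member of a tree line given by a node. -/
def ofNode {α : Ω} {t : Ω → ℕ} (hX : α ∈ X) (hα : Order.IsSuccLimit α) (h : IsNode E α t) :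
    TreeLine E X := ⟨toLex t, α, hX, hα, h⟩

theorem fn_ofNode {α : Ω} {t : Ω → ℕ} (hX : α ∈ X) (hα : Order.IsSuccLimit α)
    (h : IsNode E α t) : (ofNode hX hα h).fn = t := rfl

theorem ht_ofNode (hE : IsCoherent E) {α : Ω} {t : Ω → ℕ} (hX : α ∈ X) (hα : Order.IsSuccLimit α)
    (h : IsNode E α t) : (ofNode hX hα h).ht = α :=
  (ofNode hX hα h).isNode.height_unique hE (ofNode hX hα h).ht_lim hα h

/-- If `t` reaches beyond the split `δ₀`, follow it to some `δ > δ₀` and raise the value there.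
Otherwise `t` is already zero at `δ₀`: follow `u` to `δ₀`, put `0` there and continue with `E γ`,
which is nonzero later. What matters is that the threshold `δ` is below `α`, so that a closure point
`α` allows `γ < α`. -/
theorem exists_between (hE : IsCoherent E) {t u : TreeLine E X} (htu : t < u) {α : Ω}
    (hα : Order.IsSuccLimit α) (hu : α ≤ u.ht)
    (hne : ¬ (α ≤ t.ht ∧ ∀ ξ < α, t.fn ξ = u.fn ξ)) :
    ∃ δ < α, ∀ γ ∈ X, Order.IsSuccLimit γ → δ < γ → ∃ w, t < w ∧ w < u ∧ w.ht = γ := by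
  obtain ⟨δ₀, hag, hlt⟩ := lt_iff.1 htu
  rcases lt_or_ge δ₀ t.ht with h0 | h0
  · obtain ⟨δ, h1, h2, h3⟩ : ∃ δ, δ₀ < δ ∧ δ ≤ t.ht ∧ δ < α := by
      rcases lt_or_ge t.ht α with h | h
      · exact ⟨_, h0, le_rfl, h⟩
      · have : δ₀ < α := by
          by_contra! h'
          exact hne ⟨h, fun ξ hξ => hag ξ (hξ.trans_le h')⟩
        obtain ⟨δ, h1, h2⟩ := exists_lt_lt_of_not_covBy this (hα.2 _)
        exact ⟨δ, h1, (h2.trans_le h).le, h2⟩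
    refine ⟨δ, h3, fun γ hγ hγl hδγ =>
      ⟨ofNode hγ hγl (t.isNode.graft hE h2 hδγ (t.fn δ + 1)), ?_, ?_, ht_ofNode hE _ _ _⟩⟩
    · refine lt_iff.2 ⟨δ, fun ξ hξ => ?_, ?_⟩
      · rw [fn_ofNode, graft_of_lt _ _ _ hξ]
      · rw [fn_ofNode, graft_self]
        exact Nat.lt_succ_self _
    · refine lt_iff.2 ⟨δ₀, fun ξ hξ => ?_, ?_⟩
      · rw [fn_ofNode, graft_of_lt _ _ _ (hξ.trans h1), hag ξ hξ]
      · rwa [fn_ofNode, graft_of_lt _ _ _ h1]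
  · have h1 : t.ht < α := by
      by_contra! h'
      exact hne ⟨h', fun ξ hξ => hag ξ (hξ.trans_le (h'.trans h0))⟩
    obtain ⟨ξ, h2, h3, h4⟩ := u.isNode.exists_ne_zero hE hα hu h1
    have h5 : δ₀ < α := by
      refine lt_of_le_of_lt ?_ h3
      by_contra! h'
      exact h4 ((hag ξ h').symm.trans (t.isNode.1 ξ h2))
    refine ⟨δ₀, h5, fun γ hγ hγl hδγ =>
      ⟨ofNode hγ hγl (u.isNode.graft hE (h5.trans_le hu).le hδγ 0), ?_, ?_, ht_ofNode hE _ _ _⟩⟩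
    · obtain ⟨δ₁, k1, k2⟩ := exists_lt_lt_of_not_covBy hδγ (hγl.2 _)
      obtain ⟨η, k3, k4, k5⟩ := (hE.isNode γ).exists_ne_zero hE hγl le_rfl k2
      refine lt_of_le_of_ne (Pi.toLex_monotone (a := t.fn) fun ζ => ?_) fun heq => ?_
      · change t.fn ζ ≤ graft u.fn δ₀ 0 (E γ) ζ
        rcases lt_or_ge ζ δ₀ with hζ | hζ
        · rw [graft_of_lt _ _ _ hζ, hag ζ hζ]
        · rw [t.isNode.1 ζ (h0.trans hζ)]
          exact Nat.zero_le _
      · have h6 : t.fn η = graft u.fn δ₀ 0 (E γ) η := congrArg (fun w => w.fn η) heq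
        rw [graft_of_gt _ _ _ (k1.trans_le k3),
          t.isNode.1 η (h0.trans (k1.trans_le k3).le)] at h6
        exact k5 h6.symm
    · refine lt_iff.2 ⟨δ₀, fun ξ hξ => ?_, ?_⟩
      · rw [fn_ofNode, graft_of_lt _ _ _ hξ]
      · rw [fn_ofNode, graft_self]
        exact (Nat.zero_le _).trans_lt hlt

/-- Zero padding makes a node least among its extensions; this is the source of the least elements
of classes. -/
theorem le_of_eqOn {t u : TreeLine E X} (h : ∀ ξ < u.ht, t.fn ξ = u.fn ξ) : u ≤ t := by
  refine Pi.toLex_monotone (a := u.fn) (b := t.fn) fun ξ => ?_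
  rcases lt_or_ge ξ u.ht with hξ | hξ
  · exact (h ξ hξ).ge
  · rw [u.isNode.1 ξ hξ]
    exact Nat.zero_le _

/-- Convexity of classes: at its first disagreement `d` would leave the interval. -/
theorem eqOn_of_le_of_le {t d u : TreeLine E X} (h1 : t ≤ d) (h2 : d ≤ u) {α : Ω}
    (h : ∀ ξ < α, t.fn ξ = u.fn ξ) : ∀ ξ < α, d.fn ξ = u.fn ξ := by
  intro ξ
  induction ξ using WellFoundedLT.induction with
  | ind ξ ih =>
    intro hξ
    have hdu : ∀ j < ξ, d.fn j = u.fn j := fun j hj => ih j hj (hj.trans hξ)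
    refine le_antisymm (Pi.apply_le_of_toLex (x := d.fn) (y := u.fn) h2 hdu) ?_
    rw [← h ξ hξ]
    exact Pi.apply_le_of_toLex (x := t.fn) (y := d.fn) h1
      fun j hj => (h j (hj.trans hξ)).trans (hdu j hj).symm

theorem le_ht_of_eqOn (hE : IsCoherent E) {Y : Set Ω} {d : TreeLine E X} {u : TreeLine E Y} {α : Ω}
    (hα : Order.IsSuccLimit α) (hu : α ≤ u.ht) (h : ∀ ξ < α, d.fn ξ = u.fn ξ) : α ≤ d.ht := by
  by_contra! hd
  obtain ⟨ξ, h1, h2, h3⟩ := u.isNode.exists_ne_zero hE hα hu hd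
  exact h3 ((h ξ h2).symm.trans (d.isNode.1 ξ h1))

theorem exists_between' (hE : IsCoherent E) {t u : TreeLine E X} (htu : t < u) :
    ∃ δ, ∀ γ ∈ X, Order.IsSuccLimit γ → δ < γ → ∃ w, t < w ∧ w < u ∧ w.ht = γ := by
  obtain ⟨δ, -, h⟩ := exists_between hE htu u.ht_lim le_rfl
    fun h => (le_of_eqOn h.2).not_gt htu
  exact ⟨δ, h⟩

/-! ### Endpoints and uncountable intervals -/

section Dense

variable [IsOmegaOne Ω] (hE : IsCoherent E) (hX : ∀ ξ, ∃ α ∈ X, Order.IsSuccLimit α ∧ ξ < α)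

include hE hX

theorem noMaxOrder : NoMaxOrder (TreeLine E X) where
  exists_gt t := by
    obtain ⟨γ, hγ, hγl, h⟩ := hX t.ht
    refine ⟨ofNode hγ hγl (t.isNode.graft hE le_rfl h 1), lt_iff.2 ⟨t.ht, fun ξ hξ => ?_, ?_⟩⟩
    · rw [fn_ofNode, graft_of_lt _ _ _ hξ]
    · rw [fn_ofNode, graft_self, t.isNode.1 _ le_rfl]
      exact Nat.one_pos

theorem noMinOrder : NoMinOrder (TreeLine E X) where
  exists_lt t := by
    obtain ⟨β, hβ⟩ := not_isMin_iff.1 t.ht_lim.1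
    obtain ⟨δ, -, h2, h3⟩ := t.isNode.exists_ne_zero hE t.ht_lim le_rfl hβ
    obtain ⟨γ, hγ, hγl, h⟩ := hX δ
    refine ⟨ofNode hγ hγl (t.isNode.graft hE h2.le h 0), lt_iff.2 ⟨δ, fun ξ hξ => ?_, ?_⟩⟩
    · rw [fn_ofNode, graft_of_lt _ _ _ hξ]
    · rw [fn_ofNode, graft_self]
      exact Nat.pos_of_ne_zero h3

theorem nonempty : Nonempty (TreeLine E X) :=
  let ⟨_, hγ, hγl, _⟩ := hX (Classical.arbitrary Ω)
  ⟨ofNode hγ hγl (hE.isNode _)⟩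

theorem not_countable_Icc {t u : TreeLine E X} (htu : t < u) : ¬ (Set.Icc t u).Countable := by
  intro hc
  obtain ⟨b, hb⟩ := IsOmegaOne.exists_bound (hc.image ht)
  obtain ⟨δ, hδ⟩ := exists_between' hE htu
  obtain ⟨γ, hγ, hγl, h⟩ := hX (max b δ)
  obtain ⟨w, h1, h2, rfl⟩ := hδ γ hγ hγl ((le_max_right _ _).trans_lt h)
  exact lt_asymm (hb _ ⟨w, ⟨h1.le, h2.le⟩, rfl⟩) ((le_max_left _ _).trans_lt h)

end Dense

theorem countable_ht_le [IsOmegaOne Ω] (E : Ω → Ω → ℕ) (X : Set Ω) (α : Ω) :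
    {t : TreeLine E X | t.ht ≤ α}.Countable := by
  refine Set.Countable.mono (s₂ := fn ⁻¹' ⋃ β ∈ Set.Iic α, {t | IsNode E β t})
    (fun t ht => Set.mem_biUnion (Set.mem_Iic.2 ht) t.isNode) ?_
  exact ((IsOmegaOne.countable_Iic α).biUnion fun β _ => countable_isNode E β).preimage
    fun s t h => ext_fn h

end TreeLine

theorem TreeLine.mk_le {Ω : Type u} [LinearOrder Ω] [WellFoundedLT Ω] [IsOmegaOne Ω]
    (hΩ : #Ω = ℵ₁) (E : Ω → Ω → ℕ) (X : Set Ω) : #(TreeLine E X) ≤ ℵ₁ := by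
  have hU : (Set.univ : Set (TreeLine E X)) = ⋃ α : Ω, {t | t.ht ≤ α} :=
    (Set.eq_univ_of_forall fun t => Set.mem_iUnion.2 ⟨t.ht, le_rfl⟩).symm
  rw [← Cardinal.mk_univ, hU]
  refine (Cardinal.mk_iUnion_le _).trans ?_
  rw [hΩ]
  refine Cardinal.mul_le_of_le (Cardinal.aleph0_le_aleph 1) le_rfl (ciSup_le' fun α => ?_)
  exact (Cardinal.le_aleph0_iff_set_countable.2 (countable_ht_le E X α)).trans
    (Cardinal.aleph0_le_aleph 1)

theorem TreeLine.isCardinalDense {Ω : Type u} [LinearOrder Ω] [WellFoundedLT Ω] [IsOmegaOne Ω]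
    (hΩ : #Ω = ℵ₁) {E : Ω → Ω → ℕ} (hE : IsCoherent E) {X : Set Ω}
    (hX : ∀ ξ, ∃ α ∈ X, Order.IsSuccLimit α ∧ ξ < α) : IsCardinalDense ℵ₁ (TreeLine E X) := by
  refine ⟨nonempty hE hX, noMinOrder hE hX, noMaxOrder hE hX, fun a b hab => le_antisymm ?_ ?_⟩
  · exact (Cardinal.mk_set_le _).trans (mk_le hΩ E X)
  · have : Uncountable (Set.Icc a b) := not_countable_iff.1 (not_countable_Icc hE hX hab)
    exact Cardinal.aleph_one_le_iff.2 (Cardinal.aleph0_lt_mk_iff.2 this)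

/-! ### Tree lines are Countryman -/

/-- `F` consists of the places up to `μ` where `s` or `t` is at most `N`, and `N` bounds both
functions wherever they differ up to `μ`; moreover one of them vanishes at `μ`. -/
structure IsPairCode {Ω : Type*} [LinearOrder Ω] (s t : Ω → ℕ) (μ : Ω) (N : ℕ) (F : Finset Ω) :
    Prop where
  mem_iff : ∀ ξ, ξ ∈ F ↔ ξ ≤ μ ∧ (s ξ ≤ N ∨ t ξ ≤ N)
  le_of_ne : ∀ ξ ≤ μ, s ξ ≠ t ξ → s ξ ≤ N ∧ t ξ ≤ N
  eq_zero : s μ = 0 ∨ t μ = 0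

/-- The values of `s` and `t` on `F`, together with the ranks of their places in `F`. -/
def pairPattern {Ω : Type*} [LinearOrder Ω] (s t : Ω → ℕ) (F : Finset Ω) : Finset (ℕ × ℕ × ℕ) :=
  F.image fun ξ => ((F.filter (· < ξ)).card, s ξ, t ξ)

namespace IsPairCode

variable {Ω : Type*} [LinearOrder Ω] {s t s' t' : Ω → ℕ} {μ μ' : Ω} {N : ℕ} {F F' : Finset Ω}

theorem mem_top (h : IsPairCode s t μ N F) : μ ∈ F :=
  (h.mem_iff μ).2 ⟨le_rfl, h.eq_zero.imp (fun h => h.trans_le (Nat.zero_le _))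
    fun h => h.trans_le (Nat.zero_le _)⟩

/-- Otherwise `F` would be a proper subset of `F'`, as `μ'` lies only in the latter. -/
theorem not_lt_of_eqOn (h : IsPairCode s t μ N F) (h' : IsPairCode s' t' μ' N F')
    (hcard : F.card = F'.card) (hs : ∀ ξ ≤ μ, s ξ = s' ξ) (ht : ∀ ξ ≤ μ, t ξ = t' ξ) :
    ¬ μ < μ' := by
  intro hlt
  have hss : F ⊂ F' := by
    refine Finset.ssubset_iff_of_subset (fun ξ hξ => ?_) |>.2 ⟨μ', h'.mem_top, fun hm => ?_⟩
    · obtain ⟨h1, h2⟩ := (h.mem_iff ξ).1 hξ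
      rw [hs ξ h1, ht ξ h1] at h2
      exact (h'.mem_iff ξ).2 ⟨h1.trans hlt.le, h2⟩
    · exact ((h.mem_iff _).1 hm).1.not_gt hlt
  exact (Finset.card_lt_card hss).ne hcard

/-- Since `F` and `F'` coincide below `δ`, it has the same rank in both, and the pattern records the
values by rank. -/
theorem eq_of_mem_of_mem (hp : pairPattern s t F = pairPattern s' t' F') {δ : Ω}
    (hlow : F.filter (· < δ) = F'.filter (· < δ)) (hδ : δ ∈ F) (hδ' : δ ∈ F') :
    s δ = s' δ ∧ t δ = t' δ := by
  have hm : ((F.filter (· < δ)).card, s δ, t δ) ∈ pairPattern s' t' F' :=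
    hp ▸ Finset.mem_image_of_mem _ hδ
  obtain ⟨η, hη, heq⟩ := Finset.mem_image.1 hm
  simp only [Prod.mk.injEq] at heq
  obtain ⟨h1, h2, h3⟩ := heq
  rw [hlow] at h1
  have hmono : ∀ a ∈ F', ∀ b, a < b → (F'.filter (· < a)).card < (F'.filter (· < b)).card := by
    intro a ha b hab
    refine Finset.card_lt_card (Finset.ssubset_iff_of_subset (fun x hx => ?_) |>.2 ⟨a, ?_, ?_⟩)
    · rw [Finset.mem_filter] at hx ⊢
      exact ⟨hx.1, hx.2.trans hab⟩
    · simp [ha, hab]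
    · simp
  rcases lt_trichotomy η δ with h | rfl | h
  · exact absurd h1 (hmono η hη δ h).ne
  · exact ⟨h2.symm, h3.symm⟩
  · exact absurd h1 (hmono δ hδ' η h).ne'

/-- On `F` both values are at most `N`; off `F'`, up to `μ'`, both exceed `N`. -/
theorem lt_and_lt_of_mem_of_notMem (h : IsPairCode s t μ N F) (h' : IsPairCode s' t' μ' N F')
    {δ : Ω} (hμ' : δ ≤ μ') (hδ : δ ∈ F) (hδ' : δ ∉ F') : s δ < s' δ ∧ t δ < t' δ := by
  obtain ⟨hμ, h1⟩ := (h.mem_iff δ).1 hδ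
  have h2 : s δ ≤ N ∧ t δ ≤ N := by
    by_cases he : s δ = t δ
    · rw [he] at h1 ⊢
      exact ⟨h1.elim id id, h1.elim id id⟩
    · exact h.le_of_ne δ hμ he
  have h3 := mt (h'.mem_iff δ).2 hδ'
  rw [not_and, not_or] at h3
  obtain ⟨h4, h5⟩ := h3 hμ'
  omega

theorem lt_and_lt_or (h : IsPairCode s t μ N F) (h' : IsPairCode s' t' μ' N F')
    (hp : pairPattern s t F = pairPattern s' t' F') {δ : Ω} (hμ : δ ≤ μ) (hμ' : δ ≤ μ')
    (hs : ∀ ξ < δ, s ξ = s' ξ) (ht : ∀ ξ < δ, t ξ = t' ξ) (hne : s δ ≠ s' δ ∨ t δ ≠ t' δ) :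
    (s δ < s' δ ∧ t δ < t' δ) ∨ (s' δ < s δ ∧ t' δ < t δ) := by
  have hlow : F.filter (· < δ) = F'.filter (· < δ) := by
    ext ξ
    simp only [Finset.mem_filter, h.mem_iff, h'.mem_iff]
    refine and_congr_left fun hξ => ?_
    rw [hs ξ hξ, ht ξ hξ]
    exact and_congr_left fun _ => iff_of_true (hξ.le.trans hμ) (hξ.le.trans hμ')
  by_cases hδ : δ ∈ F
  · by_cases hδ' : δ ∈ F'
    · obtain ⟨h1, h2⟩ := eq_of_mem_of_mem hp hlow hδ hδ'
      exact (hne.elim (· h1) (· h2)).elim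
    · exact Or.inl (lt_and_lt_of_mem_of_notMem h h' hμ' hδ hδ')
  · by_cases hδ' : δ ∈ F'
    · exact Or.inr (lt_and_lt_of_mem_of_notMem h' h hμ hδ' hδ)
    · have h1 : s δ = t δ := by
        by_contra hst
        exact hδ ((h.mem_iff δ).2 ⟨hμ, Or.inl (h.le_of_ne δ hμ hst).1⟩)
      have h2 : s' δ = t' δ := by
        by_contra hst
        exact hδ' ((h'.mem_iff δ).2 ⟨hμ', Or.inl (h'.le_of_ne δ hμ' hst).1⟩)
      omega

end IsPairCode

namespace TreeLine

variable {Ω : Type*} [LinearOrder Ω] [WellFoundedLT Ω] {E : Ω → Ω → ℕ} {X : Set Ω}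

theorem exists_isPairCode (hE : IsCoherent E) (s t : TreeLine E X) :
    ∃ N F, IsPairCode s.fn t.fn (min s.ht t.ht) N F := by
  set μ := min s.ht t.ht with hμ
  have hne : {ξ | ξ ≤ μ ∧ s.fn ξ ≠ t.fn ξ}.Finite := by
    have h1 : {ξ | ξ < μ ∧ s.fn ξ ≠ t.fn ξ}.Finite := by
      rcases le_total s.ht t.ht with h | h
      · rw [hμ, min_eq_left h]
        exact s.isNode.finite_ne hE t.isNode h
      · rw [hμ, min_eq_right h]
        exact (t.isNode.finite_ne hE s.isNode h).subset fun ξ hξ => ⟨hξ.1, hξ.2.symm⟩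
    refine (h1.insert μ).subset fun ξ hξ => ?_
    rcases hξ.1.eq_or_lt with h | h
    · exact Or.inl h
    · exact Or.inr ⟨h, hξ.2⟩
  obtain ⟨N, hN⟩ := (hne.image fun ξ => max (s.fn ξ) (t.fn ξ)).bddAbove
  have hF : {ξ | ξ ≤ μ ∧ (s.fn ξ ≤ N ∨ t.fn ξ ≤ N)}.Finite := by
    refine (((s.isNode.finite_le hE N).union (t.isNode.finite_le hE N)).insert μ).subset
      fun ξ hξ => ?_
    rcases hξ.1.eq_or_lt with h | h
    · exact Or.inl h
    · exact Or.inr (hξ.2.imp (fun h' => ⟨h.trans_le (min_le_left _ _), h'⟩)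
        fun h' => ⟨h.trans_le (min_le_right _ _), h'⟩)
  refine ⟨N, hF.toFinset, fun ξ => by simp, fun ξ hξ hst => ?_, ?_⟩
  · exact max_le_iff.1 (hN ⟨ξ, ⟨hξ, hst⟩, rfl⟩)
  · rcases le_total s.ht t.ht with h | h
    · exact Or.inl (s.isNode.1 _ (min_eq_left h).ge)
    · exact Or.inr (t.isNode.1 _ (min_eq_right h).ge)

theorem eq_of_eqOn {s t : TreeLine E X} {μ : Ω} (hs : s.ht ≤ μ) (ht : t.ht ≤ μ)
    (h : ∀ ξ ≤ μ, s.fn ξ = t.fn ξ) : s = t := by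
  refine ext_fn (funext fun ξ => ?_)
  rcases le_total ξ μ with hξ | hξ
  · exact h ξ hξ
  · rw [s.isNode.1 ξ (hs.trans hξ), t.isNode.1 ξ (ht.trans hξ)]

theorem le_or_le_of_isPairCode {s t s' t' : TreeLine E X} {N : ℕ} {F F' : Finset Ω}
    (h : IsPairCode s.fn t.fn (min s.ht t.ht) N F)
    (h' : IsPairCode s'.fn t'.fn (min s'.ht t'.ht) N F') (hside : s.ht ≤ t.ht ↔ s'.ht ≤ t'.ht)
    (hcard : F.card = F'.card) (hp : pairPattern s.fn t.fn F = pairPattern s'.fn t'.fn F') :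
    (s, t) ≤ (s', t') ∨ (s', t') ≤ (s, t) := by
  simp only [Prod.mk_le_mk]
  by_cases hs : s = s'
  · subst hs
    simpa using le_total t t'
  by_cases ht : t = t'
  · subst ht
    simpa using le_total s s'
  have hne : {ξ | s.fn ξ ≠ s'.fn ξ ∨ t.fn ξ ≠ t'.fn ξ}.Nonempty := by
    by_contra! h0
    refine hs (ext_fn (funext fun ξ => ?_))
    by_contra hξ
    exact Set.notMem_empty ξ (h0 ▸ Or.inl hξ)
  obtain ⟨δ, hδ, hmin⟩ : ∃ δ ∈ {ξ | s.fn ξ ≠ s'.fn ξ ∨ t.fn ξ ≠ t'.fn ξ},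
      ∀ ξ < δ, s.fn ξ = s'.fn ξ ∧ t.fn ξ = t'.fn ξ := by
    refine ⟨_, WellFounded.min_mem wellFounded_lt _ hne, fun ξ hξ => ?_⟩
    by_contra hcon
    exact WellFounded.not_lt_min wellFounded_lt _ (by simpa [imp_iff_not_or] using hcon) hξ
  -- If the pairs agreed up to one of the two minima, `hcard` would equate the minima and `hside`
  -- would tell which coordinate ends there; that coordinate would coincide in the two pairs.
  have hμδ : δ ≤ min s.ht t.ht ∧ δ ≤ min s'.ht t'.ht := by
    rw [← le_min_iff]
    by_contra! hlt
    have hμ : min s.ht t.ht = min s'.ht t'.ht := by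
      rcases lt_trichotomy (min s.ht t.ht) (min s'.ht t'.ht) with hc | hc | hc
      · rw [min_eq_left hc.le] at hlt
        exact absurd hc (h.not_lt_of_eqOn h' hcard (fun ξ hξ => (hmin ξ (hξ.trans_lt hlt)).1)
          fun ξ hξ => (hmin ξ (hξ.trans_lt hlt)).2)
      · exact hc
      · rw [min_eq_right hc.le] at hlt
        exact absurd hc (h'.not_lt_of_eqOn h hcard.symm
          (fun ξ hξ => (hmin ξ (hξ.trans_lt hlt)).1.symm)
          fun ξ hξ => (hmin ξ (hξ.trans_lt hlt)).2.symm)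
    rw [hμ, min_self] at hlt
    rcases le_total s.ht t.ht with hc | hc
    · have hc' := hside.1 hc
      rw [min_eq_left hc, min_eq_left hc'] at hμ
      rw [min_eq_left hc'] at hlt
      exact hs (eq_of_eqOn hμ.le le_rfl fun ξ hξ => (hmin ξ (hξ.trans_lt hlt)).1)
    · have hc' : t'.ht ≤ s'.ht := by
        -- A tie `s.ht = t.ht` leaves the side undecided, but then `s` ends at the minimum too.
        by_contra! hc'
        have h1 := le_antisymm hc (hside.2 hc'.le)
        rw [h1, min_self, min_eq_left hc'.le] at hμ
        rw [min_eq_left hc'.le] at hlt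
        exact hs (eq_of_eqOn hμ.le le_rfl fun ξ hξ => (hmin ξ (hξ.trans_lt hlt)).1)
      rw [min_eq_right hc, min_eq_right hc'] at hμ
      rw [min_eq_right hc'] at hlt
      exact ht (eq_of_eqOn hμ.le le_rfl fun ξ hξ => (hmin ξ (hξ.trans_lt hlt)).2)
  have hs' : ∀ ξ < δ, s.fn ξ = s'.fn ξ := fun ξ hξ => (hmin ξ hξ).1
  have ht' : ∀ ξ < δ, t.fn ξ = t'.fn ξ := fun ξ hξ => (hmin ξ hξ).2
  rcases h.lt_and_lt_or h' hp hμδ.1 hμδ.2 hs' ht' hδ with hc | hc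
  · exact Or.inl ⟨(lt_iff.2 ⟨δ, hs', hc.1⟩).le, (lt_iff.2 ⟨δ, ht', hc.2⟩).le⟩
  · exact Or.inr ⟨(lt_iff.2 ⟨δ, fun ξ hξ => (hs' ξ hξ).symm, hc.1⟩).le,
      (lt_iff.2 ⟨δ, fun ξ hξ => (ht' ξ hξ).symm, hc.2⟩).le⟩

theorem isCountryman [IsOmegaOne Ω] (hE : IsCoherent E)
    (hX : ∀ ξ, ∃ α ∈ X, Order.IsSuccLimit α ∧ ξ < α) : IsCountryman (TreeLine E X) := by
  refine ⟨not_countable_iff.1 fun hc => ?_, ?_⟩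
  · obtain ⟨t⟩ := nonempty hE hX
    obtain ⟨u, hu⟩ := (noMaxOrder hE hX).exists_gt t
    exact not_countable_Icc hE hX hu (Set.to_countable _)
  classical
  choose N F h using fun p : TreeLine E X × TreeLine E X => exists_isPairCode hE p.1 p.2
  let code : TreeLine E X × TreeLine E X → Bool × ℕ × ℕ × Finset (ℕ × ℕ × ℕ) := fun p =>
    (decide (p.1.ht ≤ p.2.ht), N p, (F p).card, pairPattern p.1.fn p.2.fn (F p))
  refine ⟨fun n => {p | Encodable.encode (code p) = n}, fun n p hp q hq _ => ?_,
    Set.eq_univ_of_forall fun p => Set.mem_iUnion.2 ⟨_, rfl⟩⟩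
  have hpq : code p = code q := Encodable.encode_injective (Eq.trans hp (Eq.symm hq))
  simp only [code, Prod.mk.injEq, decide_eq_decide] at hpq
  obtain ⟨h1, h2, h3, h4⟩ := hpq
  have hp' := h p
  rw [h2] at hp'
  exact le_or_le_of_isPairCode hp' (h q) h1 h3 h4

/-! ### Epimorphisms between tree lines -/

theorem not_surjective_of_stationary [IsOmegaOne Ω] (hE : IsCoherent E) {Y : Set Ω}
    (hX : ∀ ξ, ∃ α ∈ X, Order.IsSuccLimit α ∧ ξ < α)
    (hY : ∀ ξ, ∃ α ∈ Y, Order.IsSuccLimit α ∧ ξ < α) (hst : IsOmegaOne.Stationary (X \ Y))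
    (f : TreeLine E X →o TreeLine E Y) : ¬ Function.Surjective f := by
  intro hf
  choose r hr using hf
  choose gX hX1 hX2 hX3 using hX
  choose gY hY1 hY2 hY3 using hY
  have hF : ∀ ξ : Ω, ∃ b, ∀ t : TreeLine E X, t.ht ≤ ξ → (f t).ht < b := fun ξ => by
    obtain ⟨b, hb⟩ := IsOmegaOne.exists_bound ((countable_ht_le E X ξ).image fun t => (f t).ht)
    exact ⟨b, fun t ht => hb _ ⟨t, ht, rfl⟩⟩
  have hR : ∀ ξ : Ω, ∃ b, ∀ t : TreeLine E Y, t.ht ≤ ξ → (r t).ht < b := fun ξ => by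
    obtain ⟨b, hb⟩ := IsOmegaOne.exists_bound ((countable_ht_le E Y ξ).image fun t => (r t).ht)
    exact ⟨b, fun t ht => hb _ ⟨t, ht, rfl⟩⟩
  choose bF hbF using hF
  choose bR hbR using hR
  -- Closure under these bounds makes `f` and its section `r` preserve height below `α`, and makes
  -- heights from `X` and from `Y` cofinal in `α`.
  obtain ⟨α, ⟨hαX, hαY⟩, hm, hc⟩ := hst fun η => max (max (gX η) (gY η)) (max (bF η) (bR η))
  simp only [max_lt_iff] at hc
  have hα : Order.IsSuccLimit α := IsOmegaOne.isSuccLimit_of_closed hX3 hm fun η hη => (hc η hη).1.1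
  have hfα : ∀ t : TreeLine E X, t.ht < α → (f t).ht < α := fun t ht =>
    (hbF _ t le_rfl).trans (hc _ ht).2.1
  have hrα : ∀ t : TreeLine E Y, t.ht < α → (r t).ht < α := fun t ht =>
    (hbR _ t le_rfl).trans (hc _ ht).2.2
  have hr_ht : ∀ t : TreeLine E Y, α ≤ t.ht → α ≤ (r t).ht := by
    intro t ht
    by_contra! h
    have := hfα _ h
    rw [hr] at this
    exact ht.not_gt this
  -- below `α`, both lines are cofinal enough to separate nodes that differ below `α`
  have sepX : ∀ t u : TreeLine E X, t < u → α ≤ u.ht →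
      ¬ (α ≤ t.ht ∧ ∀ ξ < α, t.fn ξ = u.fn ξ) → ∃ w, t < w ∧ w < u ∧ w.ht < α := by
    intro t u htu hu hne
    obtain ⟨δ, hδ, h⟩ := exists_between hE htu hα hu hne
    obtain ⟨w, h1, h2, h3⟩ := h _ (hX1 δ) (hX2 δ) (hX3 δ)
    exact ⟨w, h1, h2, h3 ▸ (hc δ hδ).1.1⟩
  have sepY : ∀ t u : TreeLine E Y, t < u → α ≤ u.ht →
      ¬ (α ≤ t.ht ∧ ∀ ξ < α, t.fn ξ = u.fn ξ) → ∃ w, t < w ∧ w < u ∧ w.ht < α := by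
    intro t u htu hu hne
    obtain ⟨δ, hδ, h⟩ := exists_between hE htu hα hu hne
    obtain ⟨w, h1, h2, h3⟩ := h _ (hY1 δ) (hY2 δ) (hY3 δ)
    exact ⟨w, h1, h2, h3 ▸ (hc δ hδ).1.2⟩
  -- `m` is the restriction to `α` of a preimage of `b`, hence the least node of its class
  obtain ⟨b, hb⟩ : ∃ b : TreeLine E Y, α < b.ht :=
    ⟨ofNode (hY1 α) (hY2 α) (hE.isNode _), by rw [ht_ofNode hE]; exact hY3 α⟩
  have ha := hr_ht b hb.le
  obtain ⟨m, hm_ht, hm_fn⟩ : ∃ m : TreeLine E X, m.ht = α ∧ ∀ ξ < α, m.fn ξ = (r b).fn ξ := by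
    have hnode : IsNode E α fun ξ => if ξ < α then (r b).fn ξ else 0 := by
      refine ⟨fun ξ hξ => if_neg hξ.not_gt,
        ((hE.isNode α).finite_ne hE (r b).isNode ha).subset fun ξ hξ => ⟨hξ.1, fun h => ?_⟩⟩
      exact hξ.2 ((if_pos hξ.1).trans h.symm)
    exact ⟨ofNode hαX hα hnode, ht_ofNode hE _ _ _, fun ξ hξ => if_pos hξ⟩
  have hma : m ≤ r b := le_of_eqOn fun ξ hξ => (hm_fn ξ (hm_ht ▸ hξ)).symm
  have hfm : f m ≤ b := (hr b) ▸ f.monotone hma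
  -- Otherwise a node `w` of height below `α` separates `f m` from `b`. Its preimage `r w` also has
  -- height below `α`, yet convexity puts it in the class of `m`.
  have hfm_cls : α ≤ (f m).ht ∧ ∀ ξ < α, (f m).fn ξ = b.fn ξ := by
    by_contra hne
    have hlt : f m < b := by
      refine lt_of_le_of_ne hfm fun heq => hne ?_
      rw [heq]
      exact ⟨hb.le, fun _ _ => rfl⟩
    obtain ⟨w, h1, h2, h3⟩ := sepY _ _ hlt hb.le hne
    have h4 : m ≤ r w := by
      by_contra! h
      exact h1.not_ge (hr w ▸ f.monotone h.le)
    have h5 : r w ≤ r b := by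
      by_contra! h
      exact h2.not_ge (hr w ▸ hr b ▸ f.monotone h.le)
    exact (le_ht_of_eqOn hE hα ha (eqOn_of_le_of_le h4 h5 hm_fn)).not_gt (hrα w h3)
  have hfm_ht : α < (f m).ht :=
    hfm_cls.1.lt_of_ne fun h => hαY (h ▸ (f m).ht_mem)
  -- Since `α ∉ Y`, the node `f m` is higher than `α` and can be lowered at a nonzero place past `α`
  -- within its class.
  obtain ⟨b', hb', hb'_fn⟩ : ∃ b' : TreeLine E Y, b' < f m ∧ ∀ ξ < α, b'.fn ξ = (f m).fn ξ := by
    obtain ⟨δ, h1, h2, h3⟩ := (f m).isNode.exists_ne_zero hE (f m).ht_lim le_rfl hfm_ht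
    obtain ⟨γ, hγ, hγl, hδγ⟩ : ∃ γ ∈ Y, Order.IsSuccLimit γ ∧ δ < γ := ⟨_, hY1 δ, hY2 δ, hY3 δ⟩
    refine ⟨ofNode hγ hγl ((f m).isNode.graft hE h2.le hδγ 0),
      lt_iff.2 ⟨δ, fun ξ hξ => ?_, ?_⟩, fun ξ hξ => ?_⟩
    · rw [fn_ofNode, graft_of_lt _ _ _ hξ]
    · rw [fn_ofNode, graft_self]
      exact Nat.pos_of_ne_zero h3
    · rw [fn_ofNode, graft_of_lt _ _ _ (hξ.trans_le h1)]
  have hlt : r b' < m := by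
    by_contra! h
    exact hb'.not_ge (hr b' ▸ f.monotone h)
  -- As `m` is least in its class, `r b'` lies outside it and a low `w` separates them; then `f w`
  -- is low but trapped in the class of `f m`.
  obtain ⟨w, h1, h2, h3⟩ := sepX _ _ hlt hm_ht.ge fun h => by
    refine (le_of_eqOn (fun ξ hξ => h.2 ξ (hm_ht ▸ hξ))).not_gt hlt
  have h4 : b' ≤ f w := hr b' ▸ f.monotone h1.le
  exact (le_ht_of_eqOn hE hα hfm_cls.1
    (eqOn_of_le_of_le h4 (f.monotone h2.le) hb'_fn)).not_gt (hfα w h3)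

end TreeLine

/-- There are at least `2 ^ ℵ₁` pairwise `⊴`-incomparable `ℵ₁`-dense Countryman lines. No axiom
beyond `ZFC` is needed: the lines are told apart by the stationary set of levels at which all
convex classes have a least element. -/
theorem exists_antichain_countryman :
    ∃ 𝒜 : Set LinOrd.{0}, 2 ^ ℵ₁ ≤ #𝒜 ∧ IsAntichain EpiLE 𝒜 ∧
      ∀ C ∈ 𝒜, IsCountryman C ∧ IsCardinalDense ℵ₁ C := by
  let Ω : Type := (ℵ₁ : Cardinal.{0}).ord.ToType
  have hΩ : #Ω = ℵ₁ := Cardinal.mk_ord_toType _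
  have hIio : ∀ a : Ω, #(Set.Iio a) < #Ω := fun a => Cardinal.mk_Iio_lt a (by simp [Ω])
  have : IsOmegaOne Ω :=
    ⟨fun a => Cardinal.le_aleph0_iff_set_countable.1
      (Cardinal.lt_aleph_one_iff.1 ((hIio a).trans_eq hΩ)),
      Cardinal.aleph0_lt_mk_iff.1 (Cardinal.aleph0_lt_aleph_one.trans_eq hΩ.symm)⟩
  obtain ⟨E, hE⟩ := exists_isCoherent (Ω := Ω)
  obtain ⟨I, X, hI, hX⟩ := IsOmegaOne.exists_stationary_diff (Ω := Ω)
  have hX' : ∀ K ξ, ∃ α ∈ X K, Order.IsSuccLimit α ∧ ξ < α := by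
    intro K ξ
    obtain ⟨L, hL⟩ := exists_ne K
    exact ((hX K L hL.symm).mono Set.sdiff_subset).exists_isSuccLimit ξ
  have hepi : ∀ K L, K ≠ L →
      ¬ EpiLE (LinOrd.of (TreeLine E (X L))) (LinOrd.of (TreeLine E (X K))) := by
    rintro K L hKL (he | ⟨f, hf⟩)
    · exact (not_isEmpty_iff.2 (TreeLine.nonempty hE (hX' L))) he
    · exact TreeLine.not_surjective_of_stationary hE (hX' K) (hX' L) (hX K L hKL) f hf
  have hinj : Function.Injective fun K => LinOrd.of (TreeLine E (X K)) := by
    intro K L hKL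
    by_contra hne
    refine hepi K L hne (Or.inr ?_)
    have hKL' : LinOrd.of (TreeLine E (X K)) = LinOrd.of (TreeLine E (X L)) := hKL
    rw [hKL']
    exact ⟨OrderHom.id, Function.surjective_id⟩
  refine ⟨Set.range fun K => LinOrd.of (TreeLine E (X K)), ?_, ?_, ?_⟩
  -- `LinOrd.{0}` lives one universe above `Set I`, hence the lift.
  · have h1 := Cardinal.mk_range_eq_of_injective hinj
    have h2 : (2 : Cardinal.{0}) ^ (ℵ₁ : Cardinal.{0}) ≤ #(Set I) := by
      rw [Cardinal.mk_set]
      exact Cardinal.power_le_power_left two_ne_zero (Cardinal.aleph_one_le_iff.2 (Cardinal.aleph0_lt_mk_iff.2 hI))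
    have h3 := Cardinal.lift_le.{1}.2 h2
    rw [← h1] at h3
    simpa using h3
  · rintro _ ⟨K, rfl⟩ _ ⟨L, rfl⟩ hne
    exact hepi L K fun h => hne (by rw [h])
  · rintro _ ⟨K, rfl⟩
    exact ⟨TreeLine.isCountryman hE (hX' K), TreeLine.isCardinalDense hΩ hE (hX' K)⟩

theorem mainTheorem6 :
    (∃ 𝒜 : Set LinOrd.{0}, #𝒜 = ℵ₁ ∧ IsAntichain EpiLE 𝒜 ∧
      ∀ C ∈ 𝒜, IsCountryman C ∧ IsCardinalDense ℵ₁ C) ∧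
    (MartinAxiomAlephOne →
      ∃ 𝒜 : Set LinOrd.{0}, #𝒜 = 2 ^ ℵ₁ ∧ IsAntichain EpiLE 𝒜 ∧
        ∀ C ∈ 𝒜, IsCountryman C ∧ IsCardinalDense ℵ₁ C) := by
  obtain ⟨𝒜, hcard, hanti, h𝒜⟩ := exists_antichain_countryman
  have key : ∀ κ ≤ #𝒜, ∃ ℬ : Set LinOrd.{0}, #ℬ = κ ∧ IsAntichain EpiLE ℬ ∧
      ∀ C ∈ ℬ, IsCountryman C ∧ IsCardinalDense ℵ₁ C := fun κ hκ =>
    let ⟨ℬ, hsub, hℬ⟩ := Cardinal.le_mk_iff_exists_subset.1 hκ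
    ⟨ℬ, hℬ, hanti.subset hsub, fun C hC => h𝒜 C (hsub hC)⟩
  exact ⟨key _ ((Cardinal.cantor _).le.trans hcard), fun _ => key _ hcard⟩
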